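/- Let $d\ge 1$ and $\lambda\in(0,\infty)$. Let $\Xi=\sum_{j\in\mathbb Z}\varepsilon_{\xi_j}$ be a homogeneous Poisson process on $\mathbb R^d$ with rate $\lambda$ (where $\varepsilon_x$ is the Dirac measure at $x$), let $\{Y_t,\ t\ge 0\}$ be a random process in $\mathbb R^d$ with $Y_0=0$ almost surely, and let $\{Y^{(j)}_t,\ t\ge 0\}$, $j\in\mathbb Z$, be independent copies of $\{Y_t,\ t\ge 0\}$ such that the family of processes $(Y^{(j)})_{j\in\mathbb Z}$ is independent of the family of initial positions $(\xi_j)_{j\in\mathbb Z}$. The location of the $j$-th particle at time $t$ is $X^{(j)}_t=\xi_j+Y^{(j)}_t$. Let $B\subset\mathbb R^d$ be a compact set with non-empty interior, let $n\ge 1$ and $t_1,\dots,t_n\ge 0$, and let $$N(t_1,\dots,t_n)=\sum_{j\in\mathbb Z}\mathbf 1\{X^{(j)}_{t_1}\in B,\dots,X^{(j)}_{t_n}\in B\}$$ be the number of particles that lie in $B$ at all the times $t_1,\dots,t_n$. Then the function $x\mapsto \mathbb P\{x+Y_{t_1}\in B,\dots,x+Y_{t_n}\in B\}$ is integrable on $\mathbb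 R^d$, $N(t_1,\dots,t_n)$ is almost surely finite and is Poisson distributed with mean $$\lambda\int_{\mathbb R^d}\mathbb P\{x+Y_{t_1}\in B,\dots,x+Y_{t_n}\in B\}\,dx,$$ and, for every $\theta\in\mathbb R$, $\mathbb E\exp\{\theta N(t_1,\dots,t_n)\}<\infty$ and $$\ln\mathbb E\exp\{\theta N(t_1,\dots,t_n)\}=\lambda(e^{\theta}-1)\int_{\mathbb R^d}\mathbb P\{x+Y_{t_1}\in B,\dots,x+Y_{t_n}\in B\}\,dx .$$ -/

import Mathlib

open MeasureTheory ProbabilityTheory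
open scoped NNReal ENNReal

/-- The Poisson law with mean `r`, as the law of a `[0, ∞]`-valued random variable. -/
noncomputable def poissonLaw (r : ℝ≥0) : Measure ℝ≥0∞ :=
  (poissonMeasure r).map (fun k : ℕ => (k : ℝ≥0∞))

/-- The point process `∑ j, ε_{ξ j}`, as a random measure on `ℝ^d`. -/
noncomputable def pointProcess {Ω : Type*} {d : ℕ} (ξ : ℤ → Ω → EuclideanSpace ℝ (Fin d)) (ω : Ω) :
    Measure (EuclideanSpace ℝ (Fin d)) :=
  Measure.sum fun j => Measure.dirac (ξ j ω)

/-- A random measure `Ξ` on `ℝ^d` is a homogeneous Poisson process with rate `lam`: the number of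
points in a Borel set `A` of finite volume is Poisson with mean `lam * vol A`, and the numbers of
points in finitely many pairwise disjoint Borel sets are independent. -/
structure IsHomogeneousPoissonProcess {Ω : Type*} [MeasurableSpace Ω] {d : ℕ}
    (Ξ : Ω → Measure (EuclideanSpace ℝ (Fin d))) (lam : ℝ≥0) (μ : Measure Ω) : Prop where
  poisson : ∀ A : Set (EuclideanSpace ℝ (Fin d)), MeasurableSet A → volume A ≠ ∞ →
    HasLaw (fun ω => Ξ ω A) (poissonLaw (lam * (volume A).toNNReal)) μ
  indep : ∀ (m : ℕ) (A : Fin m → Set (EuclideanSpace ℝ (Fin d))), (∀ i, MeasurableSet (A i)) →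
    Pairwise (fun i k => Disjoint (A i) (A k)) → iIndepFun (fun i ω => Ξ ω (A i)) μ

/-- A displacement process: a stochastic process in `ℝ^d` indexed by `t ≥ 0` and started at `0`. -/
structure IsDisplacementProcess {Ω : Type*} [MeasurableSpace Ω] {d : ℕ}
    (Y : ℝ≥0 → Ω → EuclideanSpace ℝ (Fin d)) (P : Measure Ω) : Prop where
  measurable : ∀ t, Measurable (Y t)
  zero : ∀ᵐ ω ∂P, Y 0 ω = 0

/-- The particle model. The initial positions `ξ j` form a homogeneous Poisson process with rate
`lam`; the displacements `Z j` are independent copies of the process `Y` (with the same law on path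
space, i.e. the same finite-dimensional distributions); and the positions are independent of the
displacements. -/
structure IsParticleModel {Ω Ω' : Type*} [MeasurableSpace Ω] [MeasurableSpace Ω'] {d : ℕ}
    (ξ : ℤ → Ω → EuclideanSpace ℝ (Fin d)) (Z : ℤ → ℝ≥0 → Ω → EuclideanSpace ℝ (Fin d))
    (μ : Measure Ω) (Y : ℝ≥0 → Ω' → EuclideanSpace ℝ (Fin d)) (P : Measure Ω') (lam : ℝ≥0) :
    Prop where
  measurable_position : ∀ j, Measurable (ξ j)
  poisson : IsHomogeneousPoissonProcess (pointProcess ξ) lam μ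
  displacement : IsDisplacementProcess Y P
  copies : ∀ j, IdentDistrib (fun ω t => Z j t ω) (fun ω' t => Y t ω') μ P
  measurable_displacement : ∀ j t, Measurable (Z j t)
  indep_displacements : iIndepFun (fun j ω t => Z j t ω) μ
  indep : IndepFun (fun ω j => ξ j ω) (fun ω j t => Z j t ω) μ

/-- The location `X_t^{(j)} = ξ_j + Z_t^{(j)}` of the `j`-th particle at time `t`. -/
noncomputable def particleLocation {Ω : Type*} {d : ℕ} (ξ : ℤ → Ω → EuclideanSpace ℝ (Fin d))
    (Z : ℤ → ℝ≥0 → Ω → EuclideanSpace ℝ (Fin d)) (j : ℤ) (t : ℝ≥0) (ω : Ω) :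
    EuclideanSpace ℝ (Fin d) :=
  ξ j ω + Z j t ω

open Classical in
/-- `N(t_1, …, t_n)`: the number, in `[0, ∞]`, of particles that lie in `B` at all the times
`t_1, …, t_n`. -/
noncomputable def jointCount {Ω : Type*} {d : ℕ} (ξ : ℤ → Ω → EuclideanSpace ℝ (Fin d))
    (Z : ℤ → ℝ≥0 → Ω → EuclideanSpace ℝ (Fin d)) (B : Set (EuclideanSpace ℝ (Fin d)))
    {n : ℕ} (t : Fin n → ℝ≥0) (ω : Ω) : ℝ≥0∞ :=
  ∑' j : ℤ, if ∀ k, particleLocation ξ Z j (t k) ω ∈ B then 1 else 0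

open Filter Topology

/-! The count `N` is an independent thinning of the Poisson process: given the positions, a particle
started at `x` is counted with probability `p(x)`, independently of the others. Integrating out the
displacements (`lintegral_prod_marks`) turns `E e^{-cN}` into `E ∏ H(ξ_j)` with `H = 1 - (1 -
e^{-c}) p`. Writing `H = e^{-f}`, this is the Laplace functional of `Ξ` at `f`, hence `exp(-λ ∫ (1 -
H)) = exp(-λ (1 - e^{-c}) ∫ p)` by `IsHomogeneousPoissonProcess.lintegral_expNeg`. That is the
Laplace transform of a Poisson law, which determines the law by `ext_of_lintegral_expNeg`.

The mean is finite because `∫ p ≤ vol B` (`lintegral_stayProb_le`). Transforms take values in `[0,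
∞]`, so finiteness of `N` is a consequence of its law and is never needed beforehand. -/

/-- The function `x ↦ e^{-x}` on `[0, ∞]`, with `e^{-∞} = 0`. -/
noncomputable def expNeg (x : ℝ≥0∞) : ℝ≥0∞ := (EReal.exp (x : EReal))⁻¹

@[simp] lemma expNeg_zero : expNeg 0 = 1 := by simp [expNeg]

lemma expNeg_add (x y : ℝ≥0∞) : expNeg (x + y) = expNeg x * expNeg y := by
  have h (z : ℝ≥0∞) : EReal.exp (z : EReal) ≠ 0 := by simp
  simp only [expNeg]
  rw [EReal.coe_ennreal_add, EReal.exp_add, ENNReal.mul_inv (.inl (h x)) (.inr (h y))]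

lemma expNeg_le_one (x : ℝ≥0∞) : expNeg x ≤ 1 := by
  simp [expNeg, EReal.coe_ennreal_nonneg]

lemma antitone_expNeg : Antitone expNeg := fun _ _ h =>
  ENNReal.inv_le_inv.2 (EReal.exp_monotone (EReal.coe_ennreal_le_coe_ennreal_iff.2 h))

lemma injective_expNeg : Function.Injective expNeg := fun x y h => by
  have := EReal.exp_strictMono.injective (inv_injective h)
  exact_mod_cast this

lemma continuous_expNeg : Continuous expNeg :=
  continuous_inv.comp (ENNReal.continuous_exp.comp continuous_coe_ennreal_ereal)

lemma measurable_expNeg : Measurable expNeg := continuous_expNeg.measurable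

lemma expNeg_sum {ι : Type*} (s : Finset ι) (f : ι → ℝ≥0∞) :
    expNeg (∑ i ∈ s, f i) = ∏ i ∈ s, expNeg (f i) := by
  classical
  induction s using Finset.induction_on with
  | empty => simp
  | insert a s ha ih => rw [Finset.sum_insert ha, Finset.prod_insert ha, expNeg_add, ih]

lemma expNeg_mul_natCast (c : ℝ≥0∞) (n : ℕ) : expNeg (c * n) = expNeg c ^ n := by
  induction n with
  | zero => simp
  | succ n ih => rw [Nat.cast_succ, mul_add, mul_one, expNeg_add, ih, pow_succ]

lemma expNeg_ofReal {x : ℝ} (hx : 0 ≤ x) :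
    expNeg (ENNReal.ofReal x) = ENNReal.ofReal (Real.exp (-x)) := by
  rw [expNeg, EReal.coe_ennreal_ofReal, max_eq_left hx, EReal.exp_coe,
    ← ENNReal.ofReal_inv_of_pos (Real.exp_pos _), Real.exp_neg]

/-- The inverse of `expNeg`, extended by `0` to `(1, ∞]`. -/
noncomputable def negLog (x : ℝ≥0∞) : ℝ≥0∞ := (-ENNReal.log x).toENNReal

lemma measurable_negLog : Measurable negLog := by
  have h : Continuous negLog := (continuous_neg.comp ENNReal.continuous_log).ereal_toENNReal
  exact h.measurable

lemma expNeg_negLog {x : ℝ≥0∞} (hx : x ≤ 1) : expNeg (negLog x) = x := by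
  have h : 0 ≤ -ENNReal.log x := by
    rw [EReal.neg_nonneg]
    simpa using ENNReal.log_monotone hx
  rw [expNeg, negLog, EReal.coe_toENNReal h, EReal.exp_neg, ENNReal.exp_log, inv_inv]

instance isProbabilityMeasure_poissonLaw (r : ℝ≥0) : IsProbabilityMeasure (poissonLaw r) :=
  Measure.isProbabilityMeasure_map (Measurable.of_discrete).aemeasurable

/-! ### Transforms of the Poisson law and uniqueness of Laplace transforms. -/

/-- The probability generating function of the Poisson law. -/
lemma lintegral_pow_poissonMeasure (r : ℝ≥0) (q : ℝ) (hq : 0 ≤ q) :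
    ∫⁻ k : ℕ, ENNReal.ofReal q ^ k ∂(poissonMeasure r) = ENNReal.ofReal (Real.exp (r * (q - 1))) := by
  rw [lintegral_countable']
  simp_rw [poissonMeasure_singleton, ← ENNReal.ofReal_pow hq]
  have hs : HasSum (fun n : ℕ => Real.exp (-r) * ((r * q) ^ n / n.factorial))
      (Real.exp (r * (q - 1))) := by
    have := (NormedSpace.expSeries_div_hasSum_exp ((r : ℝ) * q)).mul_left (Real.exp (-r))
    rw [← Real.exp_eq_exp_ℝ, ← Real.exp_add] at this
    convert! this using 1
    congr 1
    ring
  rw [← hs.tsum_eq, ENNReal.ofReal_tsum_of_nonneg (fun n => by positivity) hs.summable]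
  congr 1 with n
  rw [← ENNReal.ofReal_mul (by positivity)]
  congr 1
  rw [mul_pow]
  ring

/-- The Laplace transform of the Poisson law. -/
lemma lintegral_expNeg_poissonLaw (r : ℝ≥0) (c : ℝ≥0∞) :
    ∫⁻ x, expNeg (c * x) ∂(poissonLaw r) = expNeg (r * (1 - expNeg c)) := by
  have hc : expNeg c ≠ ∞ := ((expNeg_le_one c).trans_lt ENNReal.one_lt_top).ne
  have hc' : (expNeg c).toReal ≤ 1 := ENNReal.toReal_le_of_le_ofReal zero_le_one
    (by simpa using expNeg_le_one c)
  have hm : Measurable fun x => expNeg (c * x) := measurable_expNeg.comp (measurable_const_mul c)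
  rw [poissonLaw, lintegral_map hm Measurable.of_discrete]
  simp_rw [expNeg_mul_natCast]
  conv_lhs => rw [← ENNReal.ofReal_toReal hc]
  rw [lintegral_pow_poissonMeasure _ _ ENNReal.toReal_nonneg]
  have : (r : ℝ≥0∞) * (1 - expNeg c) = ENNReal.ofReal (r * (1 - (expNeg c).toReal)) := by
    rw [ENNReal.ofReal_mul r.coe_nonneg, ENNReal.ofReal_sub _ ENNReal.toReal_nonneg,
      ENNReal.ofReal_toReal hc]
    simp
  rw [this, expNeg_ofReal (mul_nonneg r.coe_nonneg (by linarith))]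
  congr 2
  ring

/-- The function `expNeg` as a bounded continuous real function. -/
noncomputable def expNegBCF : BoundedContinuousFunction ℝ≥0∞ ℝ :=
  BoundedContinuousFunction.ofNormedAddCommGroup (fun x => (expNeg x).toReal)
    (ENNReal.continuousOn_toReal.comp_continuous continuous_expNeg
      fun x => ((expNeg_le_one x).trans_lt ENNReal.one_lt_top).ne) 1 fun x => by
    rw [Real.norm_of_nonneg ENNReal.toReal_nonneg]
    exact ENNReal.toReal_le_of_le_ofReal zero_le_one (by simpa using expNeg_le_one x)

/-- A finite measure on `[0, ∞]` is determined by its Laplace transform. -/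
lemma ext_of_lintegral_expNeg {μ ν : Measure ℝ≥0∞} [IsFiniteMeasure μ] [IsFiniteMeasure ν]
    (h : ∀ n : ℕ, ∫⁻ x, expNeg (n * x) ∂μ = ∫⁻ x, expNeg (n * x) ∂ν) : μ = ν := by
  -- Polynomials in `e^{-x}` separate points because `e^{-x}` is injective, and their integrals are
  -- combinations of the Laplace transform at natural numbers.
  let A : StarSubalgebra ℝ (BoundedContinuousFunction ℝ≥0∞ ℝ) :=
    { toSubalgebra := (Polynomial.aeval (R := ℝ) expNegBCF).range
      star_mem' := fun {a} ha => by
        have : star a = a := by ext x; simp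
        rwa [this] }
  refine ext_of_forall_mem_subalgebra_integral_eq_of_polish (𝕜 := ℝ) (A := A) ?_ ?_
  · intro x y hxy
    refine ⟨_, ⟨_, ⟨expNegBCF, ⟨Polynomial.X, by simp⟩, rfl⟩, rfl⟩, fun he => hxy ?_⟩
    have hne (z) : expNeg z ≠ ∞ := ((expNeg_le_one z).trans_lt ENNReal.one_lt_top).ne
    exact injective_expNeg ((ENNReal.toReal_eq_toReal_iff' (hne x) (hne y)).1 he)
  · rintro _ ⟨p, rfl⟩
    induction p using Polynomial.induction_on' with
    | add p q hp hq =>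
      have hi (ρ : Measure ℝ≥0∞) [IsFiniteMeasure ρ] (p : Polynomial ℝ) :
          Integrable (fun x => (Polynomial.aeval expNegBCF p) x) ρ :=
        BoundedContinuousFunction.integrable _ _
      have key (ρ : Measure ℝ≥0∞) [IsFiniteMeasure ρ] :
          ∫ x, (Polynomial.aeval expNegBCF (p + q)) x ∂ρ
            = ∫ x, (Polynomial.aeval expNegBCF p) x ∂ρ + ∫ x, (Polynomial.aeval expNegBCF q) x ∂ρ := by
        rw [← integral_add (hi ρ p) (hi ρ q), map_add]
        rfl
      exact (key μ).trans ((congrArg₂ (· + ·) hp hq).trans (key ν).symm)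
    | monomial n a =>
      have key (ρ : Measure ℝ≥0∞) :
          ∫ x, (Polynomial.aeval expNegBCF (Polynomial.monomial n a)) x ∂ρ
            = a * (∫⁻ x, expNeg (n * x) ∂ρ).toReal := by
        have hx (x : ℝ≥0∞) : (Polynomial.aeval expNegBCF (Polynomial.monomial n a)) x
            = a * (expNeg (n * x)).toReal := by
          rw [mul_comm (n : ℝ≥0∞), expNeg_mul_natCast, ENNReal.toReal_pow,
            Polynomial.aeval_monomial]
          rfl
        simp_rw [hx]
        rw [integral_const_mul, integral_toReal]
        · exact (measurable_expNeg.comp (measurable_const_mul _)).aemeasurable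
        · exact ae_of_all _ fun x => (expNeg_le_one _).trans_lt ENNReal.one_lt_top
      exact (key μ).trans ((congrArg (fun z => a * z.toReal) (h n)).trans (key ν).symm)

/-- The moment generating function of the Poisson law. -/
lemma lintegral_exp_poissonLaw (r : ℝ≥0) (θ : ℝ) :
    ∫⁻ x, ENNReal.ofReal (Real.exp (θ * x.toReal)) ∂(poissonLaw r)
      = ENNReal.ofReal (Real.exp (r * (Real.exp θ - 1))) := by
  rw [poissonLaw, lintegral_map (by fun_prop) Measurable.of_discrete,
    ← lintegral_pow_poissonMeasure _ _ (Real.exp_pos θ).le]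
  refine lintegral_congr fun k => ?_
  rw [← ENNReal.ofReal_pow (Real.exp_pos θ).le, ← Real.exp_nat_mul, ENNReal.toReal_natCast,
    mul_comm]

lemma ae_poissonLaw_ne_top (r : ℝ≥0) : ∀ᵐ x ∂(poissonLaw r), x ≠ ∞ := by
  have hm : MeasurableSet {x : ℝ≥0∞ | x ≠ ∞} := (measurableSet_singleton _).compl
  rw [poissonLaw, ae_map_iff Measurable.of_discrete.aemeasurable hm]
  exact ae_of_all _ fun k => ENNReal.natCast_ne_top k

lemma lintegral_pointProcess {Ω : Type*} {d : ℕ} (ξ : ℤ → Ω → EuclideanSpace ℝ (Fin d)) (ω : Ω)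
    (f : EuclideanSpace ℝ (Fin d) → ℝ≥0∞) :
    ∫⁻ x, f x ∂(pointProcess ξ ω) = ∑' j, f (ξ j ω) := by
  simp [pointProcess, lintegral_sum_measure]

/-! ### The Laplace functional of the Poisson process. -/

section Laplace

variable {Ω : Type*} [MeasurableSpace Ω] {d : ℕ} {μ : Measure Ω} {lam : ℝ≥0}
  {ξ : ℤ → Ω → EuclideanSpace ℝ (Fin d)}

lemma measurable_lintegral_pointProcess (hξ : ∀ j, Measurable (ξ j))
    {f : EuclideanSpace ℝ (Fin d) → ℝ≥0∞} (hf : Measurable f) :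
    Measurable fun ω => ∫⁻ x, f x ∂(pointProcess ξ ω) := by
  simp_rw [lintegral_pointProcess]
  exact Measurable.tsum fun j => hf.comp (hξ j)

lemma measurable_pointProcess_apply (hξ : ∀ j, Measurable (ξ j))
    {A : Set (EuclideanSpace ℝ (Fin d))} (hA : MeasurableSet A) :
    Measurable fun ω => pointProcess ξ ω A := by
  simpa [lintegral_indicator hA] using
    measurable_lintegral_pointProcess hξ (measurable_one.indicator hA)

/-- The Laplace functional of a homogeneous Poisson process at a simple function which vanishes
outside a set of finite volume. -/
lemma IsHomogeneousPoissonProcess.lintegral_expNeg_simpleFunc (hξ : ∀ j, Measurable (ξ j))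
    (h : IsHomogeneousPoissonProcess (pointProcess ξ) lam μ)
    (g : SimpleFunc (EuclideanSpace ℝ (Fin d)) ℝ≥0∞)
    (hg : ∀ y, y ≠ 0 → volume (g ⁻¹' {y}) ≠ ∞) :
    ∫⁻ ω, expNeg (∫⁻ x, g x ∂(pointProcess ξ ω)) ∂μ
      = expNeg (lam * ∫⁻ x, (1 - expNeg (g x))) := by
  have hA (y) : MeasurableSet (g ⁻¹' {y}) := g.measurableSet_fiber y
  have hlin : ∫⁻ x, (1 - expNeg (g x)) = ∑ y ∈ g.range, (1 - expNeg y) * volume (g ⁻¹' {y}) := by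
    rw [← SimpleFunc.map_lintegral (fun y => 1 - expNeg y), ← SimpleFunc.lintegral_eq_lintegral]
    rfl
  -- Distinct level sets are disjoint, so their counts are independent.
  have hind : iIndepFun (fun (y : g.range) ω => pointProcess ξ ω (g ⁻¹' {(y : ℝ≥0∞)})) μ := by
    let e := g.range.equivFin
    have := h.indep g.range.card (fun i => g ⁻¹' {(e.symm i : ℝ≥0∞)}) (fun i => hA _) ?_
    · have h2 := this.precomp e.injective
      simpa [Function.comp_def] using h2
    · intro i k hik
      refine Disjoint.preimage _ (Set.disjoint_singleton.2 fun heq => hik ?_)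
      exact e.symm.injective (Subtype.ext heq)
  have hone (y : ℝ≥0∞) : ∫⁻ ω, expNeg (y * pointProcess ξ ω (g ⁻¹' {y})) ∂μ
      = expNeg (lam * ((1 - expNeg y) * volume (g ⁻¹' {y}))) := by
    -- The zero level set may have infinite volume, but its factor is `1`. Independence of the empty
    -- family shows that `μ` is a probability measure.
    rcases eq_or_ne y 0 with rfl | hy
    · have := h.indep 0 (fun _ => ∅) (fun _ => .empty) (fun i => i.elim0)
      have := this.isProbabilityMeasure
      simp
    · have hlaw := h.poisson _ (hA y) (hg y hy)
      have hm : Measurable fun x : ℝ≥0∞ => expNeg (y * x) :=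
        measurable_expNeg.comp (measurable_const_mul y)
      rw [hlaw.lintegral_comp hm.aemeasurable, lintegral_expNeg_poissonLaw, ENNReal.coe_mul,
        ENNReal.coe_toNNReal (hg y hy)]
      ring_nf
  simp_rw [SimpleFunc.lintegral_eq_lintegral, SimpleFunc.lintegral, hlin, expNeg_sum,
    Finset.mul_sum, expNeg_sum, ← hone]
  rw [← Finset.prod_coe_sort]
  simp_rw [← Finset.prod_coe_sort g.range]
  have hm (y : ℝ≥0∞) : Measurable fun x : ℝ≥0∞ => expNeg (y * x) :=
    measurable_expNeg.comp (measurable_const_mul y)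
  exact lintegral_prod_eq_prod_lintegral_of_indepFun Finset.univ
    (fun (y : g.range) ω => expNeg (y * pointProcess ξ ω (g ⁻¹' {(y : ℝ≥0∞)})))
    (hind.comp (fun y x => expNeg (y * x)) fun y => hm y)
    fun y => (hm y).comp (measurable_pointProcess_apply hξ (hA _))

/-- The Laplace functional of a homogeneous Poisson process. -/
lemma IsHomogeneousPoissonProcess.lintegral_expNeg [IsFiniteMeasure μ] (hξ : ∀ j, Measurable (ξ j))
    (h : IsHomogeneousPoissonProcess (pointProcess ξ) lam μ)
    {f : EuclideanSpace ℝ (Fin d) → ℝ≥0∞} (hf : Measurable f) :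
    ∫⁻ ω, expNeg (∫⁻ x, f x ∂(pointProcess ξ ω)) ∂μ
      = expNeg (lam * ∫⁻ x, (1 - expNeg (f x))) := by
  let K (n : ℕ) : Set (EuclideanSpace ℝ (Fin d)) := Metric.ball 0 n
  have hK (n) : MeasurableSet (K n) := measurableSet_ball
  -- Cutting off at growing balls gives nonzero level sets finite volume and keeps the sequence
  -- increasing to `f`.
  let g (n : ℕ) := (SimpleFunc.eapprox f n).restrict (K n)
  have hgx (n x) : g n x = (K n).indicator (SimpleFunc.eapprox f n) x :=
    SimpleFunc.restrict_apply _ (hK n) x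
  have hmono (x) : Monotone fun n => g n x := by
    intro m n hmn
    simp only [hgx]
    refine (Set.indicator_le_indicator (SimpleFunc.monotone_eapprox f hmn x)).trans ?_
    exact Set.indicator_le_indicator_of_subset
      (Metric.ball_subset_ball (by exact_mod_cast hmn)) (fun _ => zero_le) x
  have hlim (x) : Tendsto (fun n => g n x) atTop (𝓝 (f x)) := by
    refine (SimpleFunc.tendsto_eapprox hf x).congr' ?_
    obtain ⟨N, hN⟩ := exists_nat_gt ‖x‖
    filter_upwards [eventually_ge_atTop N] with n hn
    rw [hgx, Set.indicator_of_mem]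
    simp only [K, mem_ball_zero_iff]
    exact hN.trans_le (by exact_mod_cast hn)
  have hfin (n y) (hy : y ≠ 0) : volume (g n ⁻¹' {y}) ≠ ∞ := by
    rw [SimpleFunc.restrict_preimage_singleton _ (hK n) hy]
    exact measure_ne_top_of_subset Set.inter_subset_left measure_ball_lt_top.ne
  have hL : Tendsto (fun n => ∫⁻ ω, expNeg (∫⁻ x, g n x ∂(pointProcess ξ ω)) ∂μ) atTop
      (𝓝 (∫⁻ ω, expNeg (∫⁻ x, f x ∂(pointProcess ξ ω)) ∂μ)) := by
    refine tendsto_lintegral_of_dominated_convergence (fun _ => 1)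
      (fun n => measurable_expNeg.comp (measurable_lintegral_pointProcess hξ (g n).measurable))
      (fun n => ae_of_all _ fun ω => expNeg_le_one _) (by simp) (ae_of_all _ fun ω => ?_)
    refine (continuous_expNeg.tendsto _).comp ?_
    exact lintegral_tendsto_of_tendsto_of_monotone (fun n => (g n).measurable.aemeasurable)
      (ae_of_all _ hmono) (ae_of_all _ hlim)
  have hR : Tendsto (fun n => expNeg (lam * ∫⁻ x, (1 - expNeg (g n x)))) atTop
      (𝓝 (expNeg (lam * ∫⁻ x, (1 - expNeg (f x))))) := by
    refine (continuous_expNeg.tendsto _).comp ?_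
    refine ENNReal.Tendsto.const_mul ?_ (.inr ENNReal.coe_ne_top)
    -- Since `1 - e^{-g}` increases with `g`, monotone convergence applies even if the limit
    -- integral is infinite.
    refine lintegral_tendsto_of_tendsto_of_monotone
      (fun n => (measurable_const.sub (measurable_expNeg.comp (g n).measurable)).aemeasurable)
      (ae_of_all _ fun x m n hmn => tsub_le_tsub_left (antitone_expNeg (hmono x hmn)) 1)
      (ae_of_all _ fun x => ?_)
    exact ENNReal.Tendsto.sub tendsto_const_nhds ((continuous_expNeg.tendsto _).comp (hlim x))
      (.inl ENNReal.one_ne_top)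
  refine tendsto_nhds_unique hL (hR.congr fun n => ?_)
  exact (h.lintegral_expNeg_simpleFunc hξ (g n) (hfin n)).symm

end Laplace

/-! ### Integrating out independent marks. -/

/-- If the marks `W j` are independent of each other and of the points `ξ j`, then the expectation
of a finite product `∏ h (ξ j) (W j)` is obtained by integrating out the marks first. -/
lemma lintegral_prod_marks {Ω ι α β : Type*} [MeasurableSpace Ω] [MeasurableSpace α]
    [MeasurableSpace β] {μ : Measure Ω} [IsFiniteMeasure μ] {ξ : ι → Ω → α} {W : ι → Ω → β}
    (hξ : ∀ j, Measurable (ξ j)) (hW : ∀ j, Measurable (W j)) (hWi : iIndepFun W μ)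
    (hi : IndepFun (fun ω j => ξ j ω) (fun ω j => W j ω) μ)
    {h : α × β → ℝ≥0∞} (hh : Measurable h) (F : Finset ι) :
    ∫⁻ ω, ∏ j ∈ F, h (ξ j ω, W j ω) ∂μ
      = ∫⁻ ω, ∏ j ∈ F, (∫⁻ ω', h (ξ j ω, W j ω') ∂μ) ∂μ := by
  have hξ' : Measurable fun ω j => ξ j ω := measurable_pi_lambda _ hξ
  have hW' : Measurable fun ω j => W j ω := measurable_pi_lambda _ hW
  have hG : Measurable fun z : (ι → α) × (ι → β) => ∏ j ∈ F, h (z.1 j, z.2 j) :=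
    Finset.measurable_prod _ fun j _ => hh.comp (by fun_prop)
  have hmap := (indepFun_iff_map_prod_eq_prod_map_map hξ'.aemeasurable hW'.aemeasurable).1 hi
  have h1 : ∫⁻ ω, ∏ j ∈ F, h (ξ j ω, W j ω) ∂μ
      = ∫⁻ z, ∏ j ∈ F, h (z.1 j, z.2 j) ∂(μ.map fun ω => (fun j => ξ j ω, fun j => W j ω)) :=
    (lintegral_map hG (hξ'.prodMk hW')).symm
  rw [h1, hmap, lintegral_prod _ hG.aemeasurable, lintegral_map hG.lintegral_prod_right' hξ']
  refine lintegral_congr fun ω => ?_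
  have hGω : Measurable fun w : ι → β => ∏ j ∈ F, h (ξ j ω, w j) :=
    hG.comp (measurable_prodMk_left (x := fun j => ξ j ω))
  have hm (j : ι) : Measurable fun w => h (ξ j ω, w) := hh.comp measurable_prodMk_left
  refine (lintegral_map hGω hW').trans ?_
  exact lintegral_prod_eq_prod_lintegral_of_indepFun F (fun j ω' => h (ξ j ω, W j ω'))
    (hWi.comp (fun j w => h (ξ j ω, w)) hm) fun j => (hm j).comp (hW j)

/-! ### The thinned process and its count. -/

section Particles

variable {Ω Ω' : Type*} [MeasurableSpace Ω] [MeasurableSpace Ω'] {d : ℕ}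
  {μ : Measure Ω} {P : Measure Ω'} {lam : ℝ≥0}
  {ξ : ℤ → Ω → EuclideanSpace ℝ (Fin d)} {Z : ℤ → ℝ≥0 → Ω → EuclideanSpace ℝ (Fin d)}
  {Y : ℝ≥0 → Ω' → EuclideanSpace ℝ (Fin d)}

/-- The pairs of a starting point and displacements for which all the resulting locations
lie in `B`. -/
def stayIn {d : ℕ} (n : ℕ) (B : Set (EuclideanSpace ℝ (Fin d))) :
    Set (EuclideanSpace ℝ (Fin d) × (Fin n → EuclideanSpace ℝ (Fin d))) :=
  {z | ∀ k, z.1 + z.2 k ∈ B}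

lemma measurableSet_stayIn (n : ℕ) {B : Set (EuclideanSpace ℝ (Fin d))} (hB : MeasurableSet B) :
    MeasurableSet (stayIn n B) := by
  have h (k : Fin n) : Measurable fun z : EuclideanSpace ℝ (Fin d) ×
      (Fin n → EuclideanSpace ℝ (Fin d)) => z.1 + z.2 k := by fun_prop
  simp only [stayIn, Set.ofPred_forall]
  exact MeasurableSet.iInter fun k => h k hB

lemma jointCount_eq_tsum_indicator {Ω : Type*} {d : ℕ} (ξ : ℤ → Ω → EuclideanSpace ℝ (Fin d))
    (Z : ℤ → ℝ≥0 → Ω → EuclideanSpace ℝ (Fin d)) (B : Set (EuclideanSpace ℝ (Fin d)))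
    {n : ℕ} (t : Fin n → ℝ≥0) (ω : Ω) :
    jointCount ξ Z B t ω
      = ∑' j, (stayIn n B).indicator (fun _ => (1 : ℝ≥0∞)) (ξ j ω, fun k => Z j (t k) ω) := by
  classical
  refine tsum_congr fun j => ?_
  rw [Set.indicator_apply]
  congr

lemma measurable_stayProb [SFinite P] (hY : ∀ s, Measurable (Y s))
    {B : Set (EuclideanSpace ℝ (Fin d))} (hB : MeasurableSet B) {n : ℕ} (t : Fin n → ℝ≥0) :
    Measurable fun x => P {ω' | ∀ k, x + Y (t k) ω' ∈ B} := by
  have hm : Measurable fun z : EuclideanSpace ℝ (Fin d) × Ω' => (z.1, fun k => Y (t k) z.2) :=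
    measurable_fst.prodMk (measurable_pi_lambda _ fun k => (hY _).comp measurable_snd)
  exact measurable_measure_prodMk_left (hm (measurableSet_stayIn n hB))

/-- The mean volume of the set of starting points that stay in `B` is at most the
volume of `B`. -/
lemma lintegral_stayProb_le [IsProbabilityMeasure P] (hY : ∀ s, Measurable (Y s))
    {B : Set (EuclideanSpace ℝ (Fin d))} (hB : MeasurableSet B) {n : ℕ} (hn : 1 ≤ n)
    (t : Fin n → ℝ≥0) :
    ∫⁻ x, P {ω' | ∀ k, x + Y (t k) ω' ∈ B} ≤ volume B := by
  -- One observation time suffices: Tonelli and translation invariance then give exactly `vol B`.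
  -- With no times the integrand would be `1`.
  let k₀ : Fin n := ⟨0, hn⟩
  have hm : Measurable fun z : EuclideanSpace ℝ (Fin d) × Ω' => z.1 + Y (t k₀) z.2 :=
    measurable_fst.add ((hY _).comp measurable_snd)
  calc ∫⁻ x, P {ω' | ∀ k, x + Y (t k) ω' ∈ B}
      ≤ ∫⁻ x, P {ω' | x + Y (t k₀) ω' ∈ B} :=
        lintegral_mono fun x => measure_mono fun ω' h => h k₀
    _ = (volume.prod P) {z | z.1 + Y (t k₀) z.2 ∈ B} := (Measure.prod_apply (hm hB)).symm
    _ = ∫⁻ ω', volume {x | x + Y (t k₀) ω' ∈ B} ∂P := Measure.prod_apply_symm (hm hB)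
    _ = ∫⁻ _, volume B ∂P := lintegral_congr fun ω' => measure_preimage_add_right _ _ _
    _ = volume B := by simp

/-- The Laplace transform of the joint count. -/
lemma IsParticleModel.lintegral_expNeg_jointCount [IsFiniteMeasure μ] [IsProbabilityMeasure P]
    (hmodel : IsParticleModel ξ Z μ Y P lam) {B : Set (EuclideanSpace ℝ (Fin d))}
    (hB : MeasurableSet B) {n : ℕ} (t : Fin n → ℝ≥0) (c : ℝ≥0∞) :
    ∫⁻ ω, expNeg (c * jointCount ξ Z B t ω) ∂μ
      = expNeg (lam * ((1 - expNeg c) * ∫⁻ x, P {ω' | ∀ k, x + Y (t k) ω' ∈ B})) := by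
  have hY := hmodel.displacement.measurable
  let W (j : ℤ) (ω : Ω) (k : Fin n) := Z j (t k) ω
  let W' (ω' : Ω') (k : Fin n) := Y (t k) ω'
  have hW (j) : Measurable (W j) :=
    measurable_pi_lambda _ fun k => hmodel.measurable_displacement j (t k)
  have hW' : Measurable W' := measurable_pi_lambda _ fun k => hY (t k)
  -- Evaluation at the `n` times is measurable on path space, so it transfers both independence and
  -- equality in law.
  let r (f : ℝ≥0 → EuclideanSpace ℝ (Fin d)) (k : Fin n) := f (t k)
  have hr : Measurable r := measurable_pi_lambda _ fun k => measurable_pi_apply (t k)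
  have hWi : iIndepFun W μ := hmodel.indep_displacements.comp (fun _ => r) fun _ => hr
  have hi : IndepFun (fun ω j => ξ j ω) (fun ω j => W j ω) μ :=
    hmodel.indep.comp measurable_id (measurable_pi_lambda
      (fun (z : ℤ → ℝ≥0 → EuclideanSpace ℝ (Fin d)) (j : ℤ) => r (z j))
      fun j => hr.comp (measurable_pi_apply j))
  let S := stayIn n B
  have hS : MeasurableSet S := measurableSet_stayIn n hB
  let u : _ → ℝ≥0∞ := fun z => c * S.indicator (fun _ => 1) z
  have hu : Measurable u := (measurable_const.indicator hS).const_mul c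
  have hh : Measurable fun z => expNeg (u z) := measurable_expNeg.comp hu
  let H (x : EuclideanSpace ℝ (Fin d)) : ℝ≥0∞ := ∫⁻ ω', expNeg (u (x, W' ω')) ∂P
  have hH1 (x) : H x ≤ 1 :=
    (lintegral_mono fun ω' => expNeg_le_one _).trans (by simp)
  have hHm : Measurable H :=
    (hh.comp (measurable_fst.prodMk (hW'.comp measurable_snd))).lintegral_prod_right'
  have hHj (j x) : ∫⁻ ω, expNeg (u (x, W j ω)) ∂μ = H x :=
    (((hmodel.copies j).comp hr).comp (hh.comp (measurable_prodMk_left (x := x)))).lintegral_eq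
  have hH (x) : 1 - H x = (1 - expNeg c) * P {ω' | ∀ k, x + Y (t k) ω' ∈ B} := by
    have hSx : MeasurableSet {ω' | (x, W' ω') ∈ S} := (measurable_prodMk_left.comp hW') hS
    have hsub : ∫⁻ ω', (1 - expNeg (u (x, W' ω'))) ∂P = 1 - H x := by
      have hm : Measurable fun ω' => expNeg (u (x, W' ω')) :=
        hh.comp (measurable_prodMk_left.comp hW')
      rw [lintegral_sub hm _ (ae_of_all _ fun ω' => expNeg_le_one _)]
      · simp [H]
      · exact ((hH1 x).trans_lt ENNReal.one_lt_top).ne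
    rw [← hsub]
    refine Eq.trans ?_ (lintegral_indicator_const hSx (1 - expNeg c))
    refine lintegral_congr fun ω' => ?_
    by_cases hω : (x, W' ω') ∈ S <;> simp [u, hω]
  -- `H ≤ 1` makes `f = -ln H` well defined in `[0, ∞]`, with value `∞` where `H` vanishes.
  let f (x : EuclideanSpace ℝ (Fin d)) := negLog (H x)
  have hf : Measurable f := measurable_negLog.comp hHm
  have hfH (x) : expNeg (f x) = H x := expNeg_negLog (hH1 x)
  -- Marks are integrated out over finite sets of particles; dominated convergence with bound `1`
  -- then passes to all of `ℤ`.
  have key (F : Finset ℤ) : ∫⁻ ω, expNeg (∑ j ∈ F, u (ξ j ω, W j ω)) ∂μ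
      = ∫⁻ ω, expNeg (∑ j ∈ F, f (ξ j ω)) ∂μ := by
    simp_rw [expNeg_sum, hfH]
    rw [lintegral_prod_marks hmodel.measurable_position hW hWi hi hh F]
    simp_rw [hHj]
  have hlim (v : ℤ → Ω → ℝ≥0∞) (hv : ∀ j, Measurable (v j)) :
      Tendsto (fun F : Finset ℤ => ∫⁻ ω, expNeg (∑ j ∈ F, v j ω) ∂μ) atTop
        (𝓝 (∫⁻ ω, expNeg (∑' j, v j ω) ∂μ)) :=
    tendsto_lintegral_filter_of_dominated_convergence (fun _ => 1)
      (Eventually.of_forall fun F => measurable_expNeg.comp (F.measurable_fun_sum fun j _ => hv j))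
      (Eventually.of_forall fun F => ae_of_all _ fun ω => expNeg_le_one _) (by simp)
      (ae_of_all _ fun ω => (continuous_expNeg.tendsto _).comp ENNReal.summable.hasSum)
  have h1 := hlim (fun j ω => u (ξ j ω, W j ω))
    fun j => hu.comp ((hmodel.measurable_position j).prodMk (hW j))
  have h2 := hlim (fun j ω => f (ξ j ω)) fun j => hf.comp (hmodel.measurable_position j)
  have h3 := tendsto_nhds_unique h1 (h2.congr fun F => (key F).symm)
  have h4 := hmodel.poisson.lintegral_expNeg hmodel.measurable_position hf
  simp_rw [lintegral_pointProcess, hfH, hH] at h4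
  rw [lintegral_const_mul _ (measurable_stayProb hY hB t)] at h4
  rw [← h4, ← h3]
  simp only [jointCount_eq_tsum_indicator, ← ENNReal.tsum_mul_left]
  rfl

lemma IsParticleModel.measurable_jointCount (hmodel : IsParticleModel ξ Z μ Y P lam)
    {B : Set (EuclideanSpace ℝ (Fin d))} (hB : MeasurableSet B) {n : ℕ} (t : Fin n → ℝ≥0) :
    Measurable (jointCount ξ Z B t) := by
  have h : jointCount ξ Z B t = fun ω => _ := funext (jointCount_eq_tsum_indicator ξ Z B t)
  rw [h]
  refine Measurable.tsum fun j => ?_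
  exact (measurable_const.indicator (measurableSet_stayIn n hB)).comp
    ((hmodel.measurable_position j).prodMk
      (measurable_pi_lambda _ fun k => hmodel.measurable_displacement j (t k)))

end Particles

/-! ### The law of the count and its exponential moments. -/

theorem mainTheorem9 {Ω Ω' : Type*} [MeasurableSpace Ω] [MeasurableSpace Ω'] (d : ℕ)
    (μ : Measure Ω) [IsProbabilityMeasure μ] (P : Measure Ω') [IsProbabilityMeasure P]
    (lam : ℝ≥0) (hlam : 0 < lam)
    (ξ : ℤ → Ω → EuclideanSpace ℝ (Fin d)) (Z : ℤ → ℝ≥0 → Ω → EuclideanSpace ℝ (Fin d))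
    (Y : ℝ≥0 → Ω' → EuclideanSpace ℝ (Fin d))
    (hmodel : IsParticleModel ξ Z μ Y P lam)
    (B : Set (EuclideanSpace ℝ (Fin d))) (hB : IsCompact B) (hB' : (interior B).Nonempty)
    (n : ℕ) (hn : 1 ≤ n) (t : Fin n → ℝ≥0) :
    Integrable (fun x : EuclideanSpace ℝ (Fin d) =>
        P.real {ω' | ∀ k, x + Y (t k) ω' ∈ B}) volume ∧
    (∀ᵐ ω ∂μ, jointCount ξ Z B t ω ≠ ∞) ∧
    HasLaw (jointCount ξ Z B t)
      (poissonLaw (lam * (∫ x : EuclideanSpace ℝ (Fin d), P.real {ω' | ∀ k, x + Y (t k) ω' ∈ B}).toNNReal)) μ ∧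
    ∀ θ : ℝ,
      Integrable (fun ω => Real.exp (θ * (jointCount ξ Z B t ω).toReal)) μ ∧
      Real.log (∫ ω, Real.exp (θ * (jointCount ξ Z B t ω).toReal) ∂μ) =
        lam * (Real.exp θ - 1) *
          ∫ x : EuclideanSpace ℝ (Fin d), P.real {ω' | ∀ k, x + Y (t k) ω' ∈ B} := by
  have hBm := hB.measurableSet
  have hY := hmodel.displacement.measurable
  have hpm := measurable_stayProb (P := P) hY hBm t
  have hfin : ∫⁻ x, P {ω' | ∀ k, x + Y (t k) ω' ∈ B} ≠ ∞ :=
    ((lintegral_stayProb_le hY hBm hn t).trans_lt hB.measure_lt_top).ne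
  have hint : ENNReal.ofReal (∫ x, P.real {ω' | ∀ k, x + Y (t k) ω' ∈ B})
      = ∫⁻ x, P {ω' | ∀ k, x + Y (t k) ω' ∈ B} := by
    simp_rw [measureReal_def]
    rw [integral_toReal hpm.aemeasurable (ae_of_all _ fun x => measure_lt_top _ _),
      ENNReal.ofReal_toReal hfin]
  have hI0 : 0 ≤ ∫ x, P.real {ω' | ∀ k, x + Y (t k) ω' ∈ B} :=
    integral_nonneg fun x => measureReal_nonneg
  have hN := hmodel.measurable_jointCount hBm t
  have hlaw : HasLaw (jointCount ξ Z B t) (poissonLaw (lam *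
      (∫ x : EuclideanSpace ℝ (Fin d), P.real {ω' | ∀ k, x + Y (t k) ω' ∈ B}).toNNReal)) μ := by
    refine ⟨hN.aemeasurable, ?_⟩
    have := Measure.isProbabilityMeasure_map (μ := μ) hN.aemeasurable
    refine ext_of_lintegral_expNeg fun m => ?_
    have hm : Measurable fun x : ℝ≥0∞ => expNeg (m * x) :=
      measurable_expNeg.comp (measurable_const_mul _)
    rw [lintegral_map hm hN, hmodel.lintegral_expNeg_jointCount hBm, lintegral_expNeg_poissonLaw,
      ← hint, ENNReal.coe_mul, mul_assoc, mul_comm (1 - _)]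
    rfl
  have hexp (θ : ℝ) : Measurable fun x : ℝ≥0∞ => Real.exp (θ * x.toReal) := by fun_prop
  -- Computing in `[0, ∞]` first yields both integrability, not evident for `θ > 0`, and the value.
  have hmgf (θ : ℝ) : ∫⁻ ω, ENNReal.ofReal (Real.exp (θ * (jointCount ξ Z B t ω).toReal)) ∂μ
      = ENNReal.ofReal (Real.exp (lam * (Real.exp θ - 1) *
          ∫ x : EuclideanSpace ℝ (Fin d), P.real {ω' | ∀ k, x + Y (t k) ω' ∈ B})) := by
    rw [hlaw.lintegral_comp (hexp θ).ennreal_ofReal.aemeasurable, lintegral_exp_poissonLaw,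
      NNReal.coe_mul, Real.coe_toNNReal _ hI0]
    ring_nf
  have hexpN (θ : ℝ) : AEStronglyMeasurable
      (fun ω => Real.exp (θ * (jointCount ξ Z B t ω).toReal)) μ :=
    ((hexp θ).comp hN).aestronglyMeasurable
  refine ⟨?_, ?_, hlaw, fun θ => ⟨?_, ?_⟩⟩
  · exact integrable_toReal_of_lintegral_ne_top hpm.aemeasurable hfin
  · exact (hlaw.ae_iff (measurableSet_setOfPred.1 (measurableSet_singleton _).compl)).2
      (ae_poissonLaw_ne_top _)
  · refine (lintegral_ofReal_ne_top_iff_integrable (hexpN θ)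
      (ae_of_all _ fun ω => (Real.exp_pos _).le)).1 ?_
    rw [hmgf]
    exact ENNReal.ofReal_ne_top
  · rw [integral_eq_lintegral_of_nonneg_ae (ae_of_all _ fun ω => (Real.exp_pos _).le) (hexpN θ),
      hmgf, ENNReal.toReal_ofReal (Real.exp_pos _).le, Real.log_exp]
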